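/- Identify the $n$-qubit space $(\mathbb C^2)^{\otimes n}$ with functions $\{0,1\}^n\to\mathbb C$ through the computational basis. A unit vector $|\phi\rangle$ is a pure stabilizer state if it is, up to a scalar, the unique vector fixed by every element of some set of $n$-qubit Pauli operators $i^k\,\sigma_1\otimes\cdots\otimes\sigma_n$, $\sigma_j\in\{\mathbb 1,X,Y,Z\}$, $k\in\{0,1,2,3\}$. The stabilizer polytope $\mathcal S$ is the convex hull of the projectors $|\phi\rangle\langle\phi|$ on pure $n$-qubit stabilizer states. For $\gamma\in[0,1]$ let $\mathcal E_\gamma(\rho)=E_0\rho E_0^\dagger+E_1\rho E_1^\dagger$ be the single-qubit amplitude-damping channel, with $E_0=|0\rangle\langle 0|+\sqrt{1-\gamma}\,|1\rangle\langle 1|$ and $E_1=\sqrt\gamma\,|0\rangle\langle 1|$; homogeneous local amplitude damping is $\mathcal E_\gamma^{\otimes n}$. A pure stabilizer state $|\phi\rangle$ is a magic-insulator if $\mathcal E_\gamma^{\otimes n}(|\phi\rangle\langle\phi|)\in\mathcal S$ for all $\gamma\in[0,1]$, and a magic-generator if $\mathcal E_\gamma^{\otimes n}(|\phi\rangle\langle\phi|)\notin\mathcal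 S$ for every $0<\gamma<1$. **Proposition.** Let $|\phi\rangle$ be a pure $n$-qubit stabilizer state and let $A=\{x\in\{0,1\}^n:\langle x|\phi\rangle\neq 0\}$ be its computational-basis support. Then $|\phi\rangle$ is a magic-insulator if and only if all strings in $A$ have the same Hamming weight, that is, $|x|=|y|$ for all $x,y\in A$. If this condition fails, then $|\phi\rangle$ is a magic-generator. -/

import Mathlib

/-- Computational-basis labels of `n` qubits: bit strings of length `n`. -/
abbrev BitString (n : ℕ) : Type := Fin n → Fin 2

/-- Vectors of the `n`-qubit space `(ℂ²)^{⊗ n}`, given by their amplitudes in the computational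
basis. -/
abbrev QubitVec (n : ℕ) : Type := BitString n → ℂ

/-- Operators on the `n`-qubit space, in the computational basis. -/
abbrev QubitOp (n : ℕ) : Type := Matrix (BitString n) (BitString n) ℂ

/-- The tensor product `M 0 ⊗ M 1 ⊗ ⋯ ⊗ M (n - 1)` of one-qubit operators. -/
def tensorOp {n : ℕ} (M : Fin n → Matrix (Fin 2) (Fin 2) ℂ) : QubitOp n :=
  Matrix.of fun x y => ∏ i, M i (x i) (y i)

/-- The one-qubit Pauli matrices `1, X, Y, Z`. -/
def pauliMatrix : Fin 4 → Matrix (Fin 2) (Fin 2) ℂ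
  | 0 => 1
  | 1 => !![0, 1; 1, 0]
  | 2 => !![0, -Complex.I; Complex.I, 0]
  | 3 => !![1, 0; 0, -1]

/-- The `n`-qubit Pauli group: all `i ^ k • (σ_0 ⊗ ⋯ ⊗ σ_{n-1})` with every `σ_j` in
`{1, X, Y, Z}` and `k = 0, 1, 2, 3`. -/
def pauliGroup (n : ℕ) : Set (QubitOp n) :=
  {P | ∃ (k : Fin 4) (a : Fin n → Fin 4),
    P = Complex.I ^ (k : ℕ) • tensorOp fun i => pauliMatrix (a i)}

/-- `φ` is a pure stabilizer state: a unit vector that is, up to a scalar, the unique vector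
fixed by all elements of some set `S` of Pauli operators. The fixed space of `S` is that of the
subgroup generated by `S`, and this subgroup is automatically abelian and does not contain `-1`,
since it fixes `φ ≠ 0`. -/
def IsPureStabilizer {n : ℕ} (φ : QubitVec n) : Prop :=
  ∑ x, ‖φ x‖ ^ 2 = 1 ∧
    ∃ S : Set (QubitOp n), S ⊆ pauliGroup n ∧
      ∀ ψ : QubitVec n, (∀ P ∈ S, P.mulVec ψ = ψ) ↔ ∃ c : ℂ, ψ = c • φ

/-- The rank-one operator `|φ⟩⟨φ|`. -/
def ketbra {n : ℕ} (φ : QubitVec n) : QubitOp n :=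
  Matrix.vecMulVec φ (star φ)

/-- The `n`-qubit stabilizer polytope: the convex hull of the projectors `|φ⟩⟨φ|` on pure
stabilizer states. -/
def stabilizerPolytope (n : ℕ) : Set (QubitOp n) :=
  convexHull ℝ {ρ | ∃ φ : QubitVec n, IsPureStabilizer φ ∧ ρ = ketbra φ}

/-- The no-jump Kraus operator `E₀ = |0⟩⟨0| + √(1-γ) |1⟩⟨1|` of amplitude damping. -/
noncomputable def dampingKraus₀ (γ : ℝ) : Matrix (Fin 2) (Fin 2) ℂ :=
  !![1, 0; 0, ((Real.sqrt (1 - γ) : ℝ) : ℂ)]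

/-- The jump Kraus operator `E₁ = √γ |0⟩⟨1|` of amplitude damping. -/
noncomputable def dampingKraus₁ (γ : ℝ) : Matrix (Fin 2) (Fin 2) ℂ :=
  !![0, ((Real.sqrt γ : ℝ) : ℂ); 0, 0]

/-- The `n`-qubit Kraus operator `K_J`: `E₁` on the qubits in `J`, `E₀` on the others. -/
noncomputable def dampingBranch {n : ℕ} (γ : ℝ) (J : Finset (Fin n)) : QubitOp n :=
  tensorOp fun i => if i ∈ J then dampingKraus₁ γ else dampingKraus₀ γ

/-- Homogeneous local amplitude damping `𝓔_γ^{⊗ n}`, `ρ ↦ ∑_J K_J ρ K_J†`: every qubit undergoes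
amplitude damping with the same strength `γ`. -/
noncomputable def amplitudeDamping {n : ℕ} (γ : ℝ) (ρ : QubitOp n) : QubitOp n :=
  ∑ J : Finset (Fin n), dampingBranch γ J * ρ * (dampingBranch γ J).conjTranspose

/-- `φ` stays in the stabilizer polytope for all damping strengths `γ ∈ [0, 1]`. -/
def IsMagicInsulator {n : ℕ} (φ : QubitVec n) : Prop :=
  ∀ γ ∈ Set.Icc (0 : ℝ) 1, amplitudeDamping γ (ketbra φ) ∈ stabilizerPolytope n

/-- `φ` is outside the stabilizer polytope for every damping strength `0 < γ < 1`. -/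
def IsMagicGenerator {n : ℕ} (φ : QubitVec n) : Prop :=
  ∀ γ ∈ Set.Ioo (0 : ℝ) 1, amplitudeDamping γ (ketbra φ) ∉ stabilizerPolytope n

/-- All strings in the computational-basis support of `φ` have the same Hamming weight. -/
def HasConstantWeightSupport {n : ℕ} (φ : QubitVec n) : Prop :=
  ∀ x ∈ Function.support φ, ∀ y ∈ Function.support φ, hammingNorm x = hammingNorm y

/-! Write `L_J` for `lowering J`. The branch `K_J` has entries `√γ^|J| √(1-γ)^|x| L_J(x, y)`, and
`L_J` lowers the weight by exactly `|J|`. If the support of `φ` has constant weight, the damping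
factor is therefore constant on each branch, and `K_J φ` is a multiple of `L_J φ`. Since `L_J` is a
product of Pauli measurements and bit flips, `L_J φ` is zero or proportional to a stabilizer state
(`SpansStabilizerLine.lowering_mulVec`). Trace preservation makes the output a convex combination of
stabilizer projectors.

Conversely, the nonzero amplitudes of a stabilizer state have equal modulus
(`SpansStabilizerLine.norm_apply_eq`), so `|ρ u v| ≤ ρ v v` on the polytope. Take `v` of maximal
weight in the support and `u` in the support of smaller weight. Only the no-jump branch reaches `v`,
and for `0 < γ < 1` it damps the entry at `(u, v)` less than the one at `(v, v)`, which violates the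
inequality. -/

open Matrix

/-! ### Algebra of tensor products of one-qubit operators. -/

section TensorOp

variable {n : ℕ}

theorem tensorOp_mul (M N : Fin n → Matrix (Fin 2) (Fin 2) ℂ) :
    tensorOp M * tensorOp N = tensorOp fun i => M i * N i := by
  ext x y
  simp only [tensorOp, Matrix.mul_apply, Matrix.of_apply, ← Finset.prod_mul_distrib]
  exact (Fintype.prod_sum fun i j => M i (x i) j * N i j (y i)).symm

theorem tensorOp_one : tensorOp (fun _ : Fin n => (1 : Matrix (Fin 2) (Fin 2) ℂ)) = 1 := by
  ext x y
  simp only [tensorOp, Matrix.of_apply, Matrix.one_apply, Finset.prod_ite_zero, funext_iff]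
  simp

theorem tensorOp_conjTranspose (M : Fin n → Matrix (Fin 2) (Fin 2) ℂ) :
    (tensorOp M)ᴴ = tensorOp fun i => (M i)ᴴ := by
  ext x y
  simp [tensorOp, Matrix.conjTranspose_apply]

theorem tensorOp_smul (c : Fin n → ℂ) (M : Fin n → Matrix (Fin 2) (Fin 2) ℂ) :
    (tensorOp fun i => c i • M i) = (∏ i, c i) • tensorOp M := by
  ext x y
  simp [tensorOp, Finset.prod_mul_distrib]

/-- Expanding a tensor product of sums. -/
theorem sum_tensorOp_ite (M N : Fin n → Matrix (Fin 2) (Fin 2) ℂ) :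
    (∑ J : Finset (Fin n), tensorOp fun i => if i ∈ J then M i else N i) =
      tensorOp fun i => M i + N i := by
  ext x y
  simp only [tensorOp, Matrix.sum_apply, Matrix.of_apply, Matrix.add_apply, Finset.prod_add,
    Finset.powerset_univ]
  refine Finset.sum_congr rfl fun J _ => ?_
  rw [← Finset.prod_mul_prod_compl J, Finset.compl_eq_univ_sdiff]
  congr 1
  · exact Finset.prod_congr rfl fun i hi => by simp [hi]
  · exact Finset.prod_congr rfl fun i hi => by simp [(Finset.mem_sdiff.1 hi).2]

end TensorOp

/-! ### The one-qubit Pauli matrices. -/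

section OneQubit

theorem pauliMatrix_mul (a b : Fin 4) :
    ∃ (k : ℕ) (c : Fin 4), pauliMatrix a * pauliMatrix b = Complex.I ^ k • pauliMatrix c := by
  fin_cases a <;> fin_cases b
  · exact ⟨0, 0, by simp [pauliMatrix]⟩
  · exact ⟨0, 1, by simp [pauliMatrix]⟩
  · exact ⟨0, 2, by simp [pauliMatrix]⟩
  · exact ⟨0, 3, by simp [pauliMatrix]⟩
  · exact ⟨0, 1, by simp [pauliMatrix]⟩
  · exact ⟨0, 0, by simp [pauliMatrix, Matrix.one_fin_two]⟩
  · exact ⟨1, 3, by simp [pauliMatrix]⟩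
  · exact ⟨3, 2, by simp [pauliMatrix, Complex.I_pow_three]⟩
  · exact ⟨0, 2, by simp [pauliMatrix]⟩
  · exact ⟨3, 3, by simp [pauliMatrix, Complex.I_pow_three]⟩
  · exact ⟨0, 0, by simp [pauliMatrix, Matrix.one_fin_two]⟩
  · exact ⟨1, 1, by simp [pauliMatrix]⟩
  · exact ⟨0, 3, by simp [pauliMatrix]⟩
  · exact ⟨1, 2, by simp [pauliMatrix]⟩
  · exact ⟨3, 1, by simp [pauliMatrix, Complex.I_pow_three]⟩
  · exact ⟨0, 0, by simp [pauliMatrix, Matrix.one_fin_two]⟩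

theorem pauliMatrix_mul_comm (a b : Fin 4) :
    ∃ k : ℕ, pauliMatrix a * pauliMatrix b = (-1 : ℂ) ^ k • (pauliMatrix b * pauliMatrix a) := by
  have h : pauliMatrix a * pauliMatrix b = pauliMatrix b * pauliMatrix a ∨
      pauliMatrix a * pauliMatrix b = -(pauliMatrix b * pauliMatrix a) := by
    fin_cases a <;> fin_cases b <;> simp [pauliMatrix]
  rcases h with h | h
  · exact ⟨0, by simpa using h⟩
  · exact ⟨1, by simpa using h⟩

theorem pauliMatrix_mul_self (a : Fin 4) : pauliMatrix a * pauliMatrix a = 1 := by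
  fin_cases a <;> simp [pauliMatrix, Matrix.one_fin_two]

theorem pauliMatrix_conjTranspose (a : Fin 4) : (pauliMatrix a)ᴴ = pauliMatrix a := by
  fin_cases a <;> ext i j <;> fin_cases i <;> fin_cases j <;>
    simp [pauliMatrix, Matrix.conjTranspose_apply]

theorem norm_pauliMatrix_apply (a : Fin 4) (i j : Fin 2) (h : pauliMatrix a i j ≠ 0) :
    ‖pauliMatrix a i j‖ = 1 := by
  revert h
  fin_cases a <;> fin_cases i <;> fin_cases j <;> simp [pauliMatrix]

theorem pauliMatrix_apply_unique (a : Fin 4) (i j k : Fin 2) (hj : pauliMatrix a i j ≠ 0)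
    (hk : pauliMatrix a i k ≠ 0) : j = k := by
  revert hj hk
  fin_cases a <;> fin_cases i <;> fin_cases j <;> fin_cases k <;> simp [pauliMatrix]

end OneQubit

/-! ### The Pauli group and its monomial matrices. -/

section PauliGroup

variable {n : ℕ}

theorem I_pow_smul_mem_pauliGroup (k : ℕ) (a : Fin n → Fin 4) :
    Complex.I ^ k • tensorOp (fun i => pauliMatrix (a i)) ∈ pauliGroup n :=
  ⟨⟨k % 4, Nat.mod_lt _ (by norm_num)⟩, a, by simp only [← Complex.I_pow_eq_pow_mod]⟩

theorem tensorOp_mem_pauliGroup (a : Fin n → Fin 4) :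
    tensorOp (fun i => pauliMatrix (a i)) ∈ pauliGroup n := by
  simpa using I_pow_smul_mem_pauliGroup 0 a

theorem neg_mem_pauliGroup {P : QubitOp n} (hP : P ∈ pauliGroup n) : -P ∈ pauliGroup n := by
  obtain ⟨k, a, rfl⟩ := hP
  convert I_pow_smul_mem_pauliGroup (k + 2) a using 1
  simp [pow_add]

theorem mul_mem_pauliGroup {P Q : QubitOp n} (hP : P ∈ pauliGroup n) (hQ : Q ∈ pauliGroup n) :
    P * Q ∈ pauliGroup n := by
  obtain ⟨k, a, rfl⟩ := hP
  obtain ⟨l, b, rfl⟩ := hQ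
  choose m c h using fun i => pauliMatrix_mul (a i) (b i)
  convert I_pow_smul_mem_pauliGroup (k + l + ∑ i, m i) c using 1
  simp only [Matrix.smul_mul, Matrix.mul_smul, tensorOp_mul, h, tensorOp_smul, smul_smul,
    Finset.prod_pow_eq_pow_sum, pow_add, mul_assoc, mul_left_comm]

theorem pauliGroup_commute_or_anticommute {P Q : QubitOp n} (hP : P ∈ pauliGroup n)
    (hQ : Q ∈ pauliGroup n) : P * Q = Q * P ∨ P * Q = -(Q * P) := by
  obtain ⟨k, a, rfl⟩ := hP
  obtain ⟨l, b, rfl⟩ := hQ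
  choose m h using fun i => pauliMatrix_mul_comm (a i) (b i)
  have key : tensorOp (fun i => pauliMatrix (a i)) * tensorOp (fun i => pauliMatrix (b i)) =
      (-1 : ℂ) ^ (∑ i, m i) •
        (tensorOp (fun i => pauliMatrix (b i)) * tensorOp (fun i => pauliMatrix (a i))) := by
    simp only [tensorOp_mul, h, tensorOp_smul, Finset.prod_pow_eq_pow_sum]
  simp only [Matrix.smul_mul, Matrix.mul_smul, key]
  rcases neg_one_pow_eq_or ℂ (∑ i, m i) with h | h <;> rw [h]
  · left
    rw [one_smul, smul_comm]
  · right
    rw [neg_one_smul, smul_neg, smul_neg, smul_comm]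

theorem pauliGroup_mul_self {P : QubitOp n} (hP : P ∈ pauliGroup n) :
    P * P = 1 ∨ P * P = -1 := by
  obtain ⟨k, a, rfl⟩ := hP
  simp only [Matrix.smul_mul, Matrix.mul_smul, tensorOp_mul, pauliMatrix_mul_self, tensorOp_one,
    smul_smul, ← mul_pow, Complex.I_mul_I]
  rcases neg_one_pow_eq_or ℂ (k : ℕ) with h | h <;> simp [h]

theorem pauliGroup_conjTranspose_mul_self {P : QubitOp n} (hP : P ∈ pauliGroup n) :
    Pᴴ * P = 1 := by
  obtain ⟨k, a, rfl⟩ := hP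
  simp [tensorOp_conjTranspose, tensorOp_mul, pauliMatrix_conjTranspose, pauliMatrix_mul_self,
    tensorOp_one, smul_smul, ← mul_pow]

theorem finite_pauliGroup (n : ℕ) : (pauliGroup n).Finite := by
  refine (Set.finite_range fun p : Fin 4 × (Fin n → Fin 4) =>
    Complex.I ^ (p.1 : ℕ) • tensorOp fun i => pauliMatrix (p.2 i)).subset ?_
  rintro P ⟨k, a, rfl⟩
  exact ⟨(k, a), rfl⟩

theorem pauliGroup_norm_apply {P : QubitOp n} (hP : P ∈ pauliGroup n) {x y : BitString n}
    (h : P x y ≠ 0) : ‖P x y‖ = 1 := by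
  obtain ⟨k, a, rfl⟩ := hP
  simp only [tensorOp, Matrix.smul_apply, Matrix.of_apply, smul_eq_mul, mul_ne_zero_iff,
    Finset.prod_ne_zero_iff] at h
  simp only [tensorOp, Matrix.smul_apply, Matrix.of_apply, smul_eq_mul, norm_mul, norm_pow,
    Complex.norm_I, one_pow, one_mul, norm_prod]
  exact Finset.prod_eq_one fun i hi => norm_pauliMatrix_apply _ _ _ (h.2 i hi)

theorem pauliGroup_apply_unique {P : QubitOp n} (hP : P ∈ pauliGroup n) {x y z : BitString n}
    (hy : P x y ≠ 0) (hz : P x z ≠ 0) : y = z := by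
  obtain ⟨k, a, rfl⟩ := hP
  simp only [tensorOp, Matrix.smul_apply, Matrix.of_apply, smul_eq_mul, mul_ne_zero_iff,
    Finset.prod_ne_zero_iff] at hy hz
  funext i
  exact pauliMatrix_apply_unique _ _ _ _ (hy.2 i (Finset.mem_univ i)) (hz.2 i (Finset.mem_univ i))

theorem pauliGroup_mulVec_apply {P : QubitOp n} (hP : P ∈ pauliGroup n) {x y : BitString n}
    (h : P x y ≠ 0) (φ : QubitVec n) : (P *ᵥ φ) x = P x y * φ y := by
  rw [Matrix.mulVec, dotProduct]
  refine Finset.sum_eq_single y (fun z _ hz => ?_) (by simp)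
  by_contra hne
  exact hz (pauliGroup_apply_unique hP (left_ne_zero_of_mul hne) h)

end PauliGroup

/-! ### Stabilizer lines, their amplitudes, and an inequality on the polytope. -/

section StabilizerLine

variable {n : ℕ}

/-- The line spanned by `φ` (which may be zero) is the fixed space of a set of Pauli operators. -/
def SpansStabilizerLine (φ : QubitVec n) : Prop :=
  ∃ S : Set (QubitOp n), S ⊆ pauliGroup n ∧
    ∀ ψ : QubitVec n, (∀ P ∈ S, P *ᵥ ψ = ψ) ↔ ∃ c : ℂ, ψ = c • φ

/-- Only the zero vector is fixed by `-1`. Admitting zero lets measurement outcomes of probability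
zero pass through the lemmas below. -/
theorem spansStabilizerLine_zero : SpansStabilizerLine (0 : QubitVec n) := by
  have hone : (1 : QubitOp n) ∈ pauliGroup n := by
    simpa [pauliMatrix, tensorOp_one] using tensorOp_mem_pauliGroup (fun _ : Fin n => 0)
  refine ⟨{-1}, by simpa using neg_mem_pauliGroup hone, fun ψ => ?_⟩
  simp [Matrix.neg_mulVec, neg_eq_self]

theorem SpansStabilizerLine.smul {φ : QubitVec n} (h : SpansStabilizerLine φ) (c : ℂ) :
    SpansStabilizerLine (c • φ) := by
  rcases eq_or_ne c 0 with rfl | hc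
  · simpa using spansStabilizerLine_zero
  · obtain ⟨S, hS, hfix⟩ := h
    refine ⟨S, hS, fun ψ => (hfix ψ).trans ⟨?_, ?_⟩⟩
    · rintro ⟨d, rfl⟩
      exact ⟨d / c, by rw [smul_smul, div_mul_cancel₀ _ hc]⟩
    · rintro ⟨d, rfl⟩
      exact ⟨d * c, by rw [smul_smul]⟩

theorem pauliGroup_mul_self_of_fixed {φ : QubitVec n} (hφ : φ ≠ 0) {P : QubitOp n}
    (hP : P ∈ pauliGroup n) (hfix : P *ᵥ φ = φ) : P * P = 1 := by
  refine (pauliGroup_mul_self hP).resolve_right fun h => hφ ?_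
  have h1 : (P * P) *ᵥ φ = φ := by rw [← Matrix.mulVec_mulVec, hfix, hfix]
  rw [h, Matrix.neg_mulVec, Matrix.one_mulVec] at h1
  exact neg_eq_self.1 h1

theorem pauliGroup_commute_of_fixed {φ : QubitVec n} (hφ : φ ≠ 0) {P Q : QubitOp n}
    (hP : P ∈ pauliGroup n) (hQ : Q ∈ pauliGroup n) (hPφ : P *ᵥ φ = φ) (hQφ : Q *ᵥ φ = φ) :
    P * Q = Q * P := by
  refine (pauliGroup_commute_or_anticommute hP hQ).resolve_right fun h => hφ ?_
  have h1 : (P * Q) *ᵥ φ = φ := by rw [← Matrix.mulVec_mulVec, hQφ, hPφ]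
  rw [h, Matrix.neg_mulVec, ← Matrix.mulVec_mulVec, hPφ, hQφ] at h1
  exact neg_eq_self.1 h1

/-- Conjugation by the involution `U` turns a set stabilizing `φ` into one stabilizing `U *ᵥ φ`. -/
theorem SpansStabilizerLine.pauli_mulVec {φ : QubitVec n} (h : SpansStabilizerLine φ)
    {U : QubitOp n} (hU : U ∈ pauliGroup n) (hU1 : U * U = 1) :
    SpansStabilizerLine (U *ᵥ φ) := by
  obtain ⟨S, hS, hfix⟩ := h
  refine ⟨(fun P => U * P * U) '' S, ?_, fun ψ => ?_⟩
  · rintro _ ⟨P, hP, rfl⟩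
    exact mul_mem_pauliGroup (mul_mem_pauliGroup hU (hS hP)) hU
  · have hinv : ∀ χ : QubitVec n, U *ᵥ (U *ᵥ χ) = χ := fun χ => by
      rw [Matrix.mulVec_mulVec, hU1, Matrix.one_mulVec]
    have h1 : (∀ P ∈ (fun P => U * P * U) '' S, P *ᵥ ψ = ψ) ↔
        ∀ P ∈ S, P *ᵥ (U *ᵥ ψ) = U *ᵥ ψ := by
      simp only [Set.forall_mem_image, ← Matrix.mulVec_mulVec]
      refine forall₂_congr fun P _ => ⟨fun h => ?_, fun h => by rw [h, hinv]⟩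
      rw [← hinv (P *ᵥ (U *ᵥ ψ)), h]
    rw [h1, hfix]
    refine exists_congr fun c => ⟨fun h => ?_, fun h => ?_⟩
    · rw [← hinv ψ, h, Matrix.mulVec_smul]
    · rw [h, Matrix.mulVec_smul, hinv]

/-- The (unnormalised) outcome `-1` of measuring a Pauli operator. -/
theorem SpansStabilizerLine.sub_pauli_mulVec {φ : QubitVec n} (h : SpansStabilizerLine φ)
    {Z : QubitOp n} (hZ : Z ∈ pauliGroup n) (hZ1 : Z * Z = 1) :
    SpansStabilizerLine (φ - Z *ᵥ φ) := by
  rcases eq_or_ne φ 0 with rfl | hφ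
  · simpa using spansStabilizerLine_zero
  have hline := h
  obtain ⟨S, hS, hfix⟩ := h
  have hSφ : ∀ P ∈ S, P *ᵥ φ = φ := (hfix φ).2 ⟨1, (one_smul _ _).symm⟩
  by_cases hcomm : ∀ P ∈ S, P * Z = Z * P
  -- If `Z` commutes with `S`, then `Z *ᵥ φ` is fixed by `S`, so `φ` is an eigenvector of `Z`.
  · obtain ⟨c, hc⟩ := (hfix (Z *ᵥ φ)).1 fun P hP => by
      rw [Matrix.mulVec_mulVec, hcomm P hP, ← Matrix.mulVec_mulVec, hSφ P hP]
    have : φ - Z *ᵥ φ = (1 - c) • φ := by rw [hc, sub_smul, one_smul]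
    rw [this]
    exact hline.smul _
  push Not at hcomm
  obtain ⟨g, hg, hgZ⟩ := hcomm
  have hanti : ∀ P ∈ S, P * Z ≠ Z * P → P * Z = -(Z * P) := fun P hP hne =>
    (pauliGroup_commute_or_anticommute (hS hP) hZ).resolve_left hne
  have hgZ' := hanti g hg hgZ
  have hg1 : g * g = 1 := pauliGroup_mul_self_of_fixed hφ (hS hg) (hSφ g hg)
  have hfixed : ∀ Q : QubitOp n, Q * Z = Z * Q → Q *ᵥ φ = φ →
      Q *ᵥ (φ - Z *ᵥ φ) = φ - Z *ᵥ φ := fun Q hQ hQφ => by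
    rw [Matrix.mulVec_sub, Matrix.mulVec_mulVec, hQ, ← Matrix.mulVec_mulVec, hQφ]
  -- The stabilizer update: keep what commutes with `Z`, multiply the rest by the anticommuting `g`
  -- so that it commutes, and adjoin `-Z`.
  refine ⟨{P | P ∈ S ∧ P * Z = Z * P} ∪ (fun P => g * P) '' {P | P ∈ S ∧ P * Z ≠ Z * P} ∪ {-Z},
    ?_, fun ψ => ⟨fun hψ => ?_, ?_⟩⟩
  · rintro P ((⟨hP, -⟩ | ⟨P, ⟨hP, -⟩, rfl⟩) | rfl)
    · exact hS hP
    · exact mul_mem_pauliGroup (hS hg) (hS hP)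
    · exact neg_mem_pauliGroup hZ
  · have hZψ : Z *ᵥ ψ = -ψ := by
      have := hψ (-Z) (Or.inr rfl)
      rw [Matrix.neg_mulVec] at this
      rw [← this, neg_neg, this]
    have hgg : g *ᵥ (g *ᵥ ψ) = ψ := by rw [Matrix.mulVec_mulVec, hg1, Matrix.one_mulVec]
    -- Elements of `S` commuting with `Z` fix both summands; the others swap them.
    obtain ⟨c, hc⟩ := (hfix (ψ + g *ᵥ ψ)).1 fun P hP => by
      have hPg : P *ᵥ (g *ᵥ ψ) = g *ᵥ (P *ᵥ ψ) := by
        rw [Matrix.mulVec_mulVec, Matrix.mulVec_mulVec,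
          pauliGroup_commute_of_fixed hφ (hS hP) (hS hg) (hSφ P hP) (hSφ g hg)]
      rw [Matrix.mulVec_add, hPg]
      by_cases hPZ : P * Z = Z * P
      · rw [hψ P (Or.inl (Or.inl ⟨hP, hPZ⟩))]
      · have h1 : g *ᵥ (P *ᵥ ψ) = ψ := by
          rw [Matrix.mulVec_mulVec]
          exact hψ _ (Or.inl (Or.inr ⟨P, ⟨hP, hPZ⟩, rfl⟩))
        have h2 : P *ᵥ ψ = g *ᵥ ψ := by
          conv_rhs => rw [← h1]
          rw [Matrix.mulVec_mulVec, hg1, Matrix.one_mulVec]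
        rw [h1, h2, add_comm]
    -- Applying `1 - Z` to `ψ + g *ᵥ ψ = c • φ` gives `2 • ψ` on the left, because `Z` negates `ψ`
    -- and fixes `g *ᵥ ψ`.
    refine ⟨c / 2, ?_⟩
    have hZg : Z *ᵥ (g *ᵥ ψ) = g *ᵥ ψ := by
      have : Z * g = -(g * Z) := by rw [hgZ', neg_neg]
      rw [Matrix.mulVec_mulVec, this, Matrix.neg_mulVec, ← Matrix.mulVec_mulVec, hZψ,
        Matrix.mulVec_neg, neg_neg]
    have h2 : (2 : ℂ) • ψ = c • (φ - Z *ᵥ φ) := by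
      rw [smul_sub, ← Matrix.mulVec_smul, ← hc, Matrix.mulVec_add, hZψ, hZg, two_smul]
      abel
    rw [div_eq_inv_mul, mul_smul, ← h2, smul_smul, inv_mul_cancel₀ two_ne_zero, one_smul]
  · rintro ⟨c, rfl⟩ P hP
    rw [Matrix.mulVec_smul]
    congr 1
    rcases hP with (⟨hP, hPZ⟩ | ⟨P, ⟨hP, hPZ⟩, rfl⟩) | rfl
    · exact hfixed P hPZ (hSφ P hP)
    · refine hfixed _ ?_ ?_
      · change g * P * Z = Z * (g * P)
        rw [Matrix.mul_assoc, hanti P hP hPZ, Matrix.mul_neg, ← Matrix.mul_assoc, hgZ',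
          Matrix.neg_mul, neg_neg, Matrix.mul_assoc]
      · rw [← Matrix.mulVec_mulVec, hSφ P hP, hSφ g hg]
    · rw [Matrix.neg_mulVec, Matrix.mulVec_sub, Matrix.mulVec_mulVec, hZ1, Matrix.one_mulVec,
        neg_sub]

theorem IsPureStabilizer.spansStabilizerLine {φ : QubitVec n} (h : IsPureStabilizer φ) :
    SpansStabilizerLine φ := h.2

theorem IsPureStabilizer.ketbra_mem {φ : QubitVec n} (h : IsPureStabilizer φ) :
    ketbra φ ∈ stabilizerPolytope n :=
  subset_convexHull ℝ _ ⟨φ, h, rfl⟩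

theorem SpansStabilizerLine.exists_ketbra {φ : QubitVec n} (h : SpansStabilizerLine φ)
    (h0 : φ ≠ 0) :
    ∃ σ ∈ stabilizerPolytope n, ketbra φ = (∑ x, ‖φ x‖ ^ 2) • σ := by
  obtain ⟨x, hx⟩ := Function.ne_iff.1 h0
  have hpos : 0 < ∑ x, ‖φ x‖ ^ 2 := Finset.sum_pos' (fun _ _ => by positivity)
    ⟨x, Finset.mem_univ x, by have := norm_pos_iff.2 hx; positivity⟩
  set s := ∑ x, ‖φ x‖ ^ 2
  have hsq : √s ^ 2 = s := Real.sq_sqrt hpos.le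
  refine ⟨ketbra ((((√s)⁻¹ : ℝ) : ℂ) • φ), IsPureStabilizer.ketbra_mem ⟨?_, h.smul _⟩, ?_⟩
  · simp only [Pi.smul_apply, norm_smul, mul_pow, ← Finset.mul_sum, Complex.norm_real, norm_inv,
      inv_pow, Real.norm_eq_abs, sq_abs, hsq]
    exact inv_mul_cancel₀ hpos.ne'
  · ext x y
    have : ((√s : ℝ) : ℂ) ^ 2 = s := by rw [← Complex.ofReal_pow, hsq]
    have hs : ((√s : ℝ) : ℂ) ≠ 0 := by
      rw [Complex.ofReal_ne_zero]; exact (Real.sqrt_pos.2 hpos).ne'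
    simp only [ketbra, Matrix.vecMulVec_apply, Matrix.smul_apply, Pi.star_apply, Pi.smul_apply,
      smul_eq_mul, star_mul', RCLike.star_def, Complex.conj_ofReal, Complex.real_smul, ← this]
    rw [Complex.ofReal_inv]
    field_simp

/-- All nonzero amplitudes of a stabilizer state have the same modulus. -/
theorem SpansStabilizerLine.norm_apply_eq {φ : QubitVec n} (h : SpansStabilizerLine φ)
    {x y : BitString n} (hx : φ x ≠ 0) (hy : φ y ≠ 0) : ‖φ x‖ = ‖φ y‖ := by
  have hφ : φ ≠ 0 := fun h0 => hx (by simp [h0])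
  obtain ⟨S, hS, hfix⟩ := h
  have hSφ : ∀ P ∈ S, P *ᵥ φ = φ := (hfix φ).2 ⟨1, (one_smul _ _).symm⟩
  have hfin : {P | P ∈ pauliGroup n ∧ P *ᵥ φ = φ}.Finite :=
    (finite_pauliGroup n).subset fun P hP => hP.1
  -- `G` is the full Pauli stabilizer of `φ`. Its sum absorbs every element of `S`, so each column
  -- of that sum is a multiple of `φ`.
  set G : Finset (QubitOp n) := hfin.toFinset
  have hG : ∀ P, P ∈ G ↔ P ∈ pauliGroup n ∧ P *ᵥ φ = φ := fun P => hfin.mem_toFinset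
  have hinv : ∀ P ∈ S, P * ∑ Q ∈ G, Q = ∑ Q ∈ G, Q := fun P hP => by
    have hP1 := pauliGroup_mul_self_of_fixed hφ (hS hP) (hSφ P hP)
    have hmem : ∀ Q ∈ G, P * Q ∈ G := fun Q hQ => by
      rw [hG] at hQ ⊢
      exact ⟨mul_mem_pauliGroup (hS hP) hQ.1, by rw [← Matrix.mulVec_mulVec, hQ.2, hSφ P hP]⟩
    rw [Finset.mul_sum]
    refine Finset.sum_nbij' (P * ·) (P * ·) hmem hmem ?_ ?_ fun _ _ => rfl <;>
      exact fun Q _ => by rw [← Matrix.mul_assoc, hP1, Matrix.one_mul]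
  obtain ⟨c, hc⟩ := (hfix ((∑ Q ∈ G, Q) *ᵥ Pi.single y 1)).1 fun P hP => by
    rw [Matrix.mulVec_mulVec, hinv P hP]
  have hstar : ∀ P ∈ G, star φ ᵥ* P = star φ := fun P hP => by
    rw [hG] at hP
    have h1 : Pᴴ *ᵥ φ = φ := by
      conv_lhs => rw [← hP.2]
      rw [Matrix.mulVec_mulVec, pauliGroup_conjTranspose_mul_self hP.1, Matrix.one_mulVec]
    conv_rhs => rw [← h1]
    rw [Matrix.star_mulVec, Matrix.conjTranspose_conjTranspose]
  have hcard : (G.card : ℂ) ≠ 0 := by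
    rw [Nat.cast_ne_zero]
    refine (Finset.card_pos.2 ⟨1, (hG 1).2 ⟨?_, Matrix.one_mulVec _⟩⟩).ne'
    simpa [pauliMatrix, tensorOp_one] using tensorOp_mem_pauliGroup (fun _ : Fin n => 0)
  -- Pairing column `y` of the sum with `φ` gives `|G|` times the conjugate of `φ y`.
  have hc0 : c ≠ 0 := fun h0 => by
    have h1 : star φ ⬝ᵥ ((∑ Q ∈ G, Q) *ᵥ Pi.single y 1) = 0 := by rw [hc, h0]; simp
    rw [Matrix.dotProduct_mulVec, Matrix.vecMul_sum, Finset.sum_congr rfl hstar] at h1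
    simp [hcard, hy] at h1
  have hsum : ∑ Q ∈ G, Q x y ≠ 0 := by
    have h1 := congrFun hc x
    rw [Matrix.mulVec_single_one, Matrix.col_apply, Matrix.sum_apply] at h1
    rw [h1]
    exact mul_ne_zero hc0 hx
  -- This `Q` fixes `φ` and is monomial with unimodular entries, so `φ x = Q x y * φ y`.
  obtain ⟨Q, hQ, hQxy⟩ := Finset.exists_ne_zero_of_sum_ne_zero hsum
  rw [hG] at hQ
  have h1 := pauliGroup_mulVec_apply hQ.1 hQxy φ
  rw [hQ.2] at h1
  rw [h1, norm_mul, pauliGroup_norm_apply hQ.1 hQxy, one_mul]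

/-- The inequality is preserved by convex combinations. At a pure stabilizer state the left side is
`0` or `‖φ y‖ ^ 2`, by equality of moduli. -/
theorem norm_apply_le_of_mem_stabilizerPolytope {ρ : QubitOp n} (hρ : ρ ∈ stabilizerPolytope n)
    (x y : BitString n) : ‖ρ x y‖ ≤ (ρ y y).re := by
  have hconv : Convex ℝ {σ : QubitOp n | ‖σ x y‖ ≤ (σ y y).re} := by
    intro σ hσ τ hτ a b ha hb _
    simp only [Set.mem_ofPred_eq, Matrix.add_apply, Matrix.smul_apply, Complex.add_re,
      Complex.smul_re] at *
    refine (norm_add_le _ _).trans ?_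
    rw [norm_smul, norm_smul, Real.norm_of_nonneg ha, Real.norm_of_nonneg hb]
    exact add_le_add (mul_le_mul_of_nonneg_left hσ ha) (mul_le_mul_of_nonneg_left hτ hb)
  refine convexHull_min ?_ hconv hρ
  rintro _ ⟨φ, hφ, rfl⟩
  have hre : (φ y * star (φ y)).re = ‖φ y‖ * ‖φ y‖ := by
    rw [RCLike.star_def, Complex.mul_conj, Complex.ofReal_re, Complex.normSq_eq_norm_sq, sq]
  simp only [Set.mem_ofPred_eq, ketbra, Matrix.vecMulVec_apply, Pi.star_apply, norm_mul, norm_star,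
    hre]
  by_cases hx : φ x = 0
  · simp [hx, mul_self_nonneg]
  by_cases hy : φ y = 0
  · simp [hy]
  · rw [hφ.spansStabilizerLine.norm_apply_eq hx hy]

end StabilizerLine

/-! ### Damping branches, and the two directions of the theorem. -/

section Damping

variable {n : ℕ}

theorem mul_ketbra_mul_conjTranspose (K : QubitOp n) (φ : QubitVec n) :
    K * ketbra φ * Kᴴ = ketbra (K *ᵥ φ) := by
  rw [ketbra, ketbra, Matrix.mul_vecMulVec, Matrix.vecMulVec_mul, Matrix.star_mulVec]

theorem amplitudeDamping_ketbra (γ : ℝ) (φ : QubitVec n) :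
    amplitudeDamping γ (ketbra φ) = ∑ J, ketbra (dampingBranch γ J *ᵥ φ) :=
  Finset.sum_congr rfl fun _ _ => mul_ketbra_mul_conjTranspose _ _

theorem sum_dampingBranch_conjTranspose_mul_self {γ : ℝ} (hγ : γ ∈ Set.Icc (0 : ℝ) 1) :
    ∑ J : Finset (Fin n), (dampingBranch γ J)ᴴ * dampingBranch γ J = 1 := by
  have h : (dampingKraus₁ γ)ᴴ * dampingKraus₁ γ + (dampingKraus₀ γ)ᴴ * dampingKraus₀ γ = 1 := by
    have h1 : ((√γ : ℝ) : ℂ) * ((√γ : ℝ) : ℂ) = γ := by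
      rw [← Complex.ofReal_mul, Real.mul_self_sqrt hγ.1]
    have h2 : ((√(1 - γ) : ℝ) : ℂ) * ((√(1 - γ) : ℝ) : ℂ) = 1 - γ := by
      rw [← Complex.ofReal_mul, Real.mul_self_sqrt (sub_nonneg.2 hγ.2)]; simp
    ext i j
    fin_cases i <;> fin_cases j <;>
      simp [dampingKraus₀, dampingKraus₁, Matrix.mul_apply, Matrix.conjTranspose_apply, h1, h2]
  rw [← tensorOp_one, ← h, ← sum_tensorOp_ite]
  refine Finset.sum_congr rfl fun J _ => ?_
  rw [dampingBranch, tensorOp_conjTranspose, tensorOp_mul]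
  congr 1
  funext i
  split_ifs <;> rfl

theorem sum_norm_sq_eq_dotProduct (φ : QubitVec n) :
    ((∑ x, ‖φ x‖ ^ 2 : ℝ) : ℂ) = star φ ⬝ᵥ φ := by
  simp [dotProduct, ← Complex.conj_mul']

theorem sum_norm_sq_dampingBranch {γ : ℝ} (hγ : γ ∈ Set.Icc (0 : ℝ) 1) (φ : QubitVec n) :
    ∑ J, ∑ x, ‖(dampingBranch γ J *ᵥ φ) x‖ ^ 2 = ∑ x, ‖φ x‖ ^ 2 := by
  apply Complex.ofReal_injective
  rw [Complex.ofReal_sum]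
  simp only [sum_norm_sq_eq_dotProduct, Matrix.star_mulVec, ← Matrix.dotProduct_mulVec,
    Matrix.mulVec_mulVec]
  rw [← dotProduct_sum, ← Matrix.sum_mulVec, sum_dampingBranch_conjTranspose_mul_self hγ,
    Matrix.one_mulVec]

/-- The operator lowering every qubit in `J`, that is `|0⟩⟨1|` on `J` and the identity elsewhere. -/
def lowering (J : Finset (Fin n)) : QubitOp n :=
  tensorOp fun i => if i ∈ J then !![0, 1; 0, 0] else 1

theorem lowering_empty : lowering (∅ : Finset (Fin n)) = 1 := by
  simp [lowering, tensorOp_one]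

theorem lowering_insert {i : Fin n} {J : Finset (Fin n)} (hi : i ∉ J) :
    lowering (insert i J) = lowering {i} * lowering J := by
  rw [lowering, lowering, lowering, tensorOp_mul]
  congr 1
  funext j
  by_cases hj : j = i
  · subst hj; simp [hi]
  · simp [hj]

/-- This is `|0⟩⟨1| = X (1 - Z) / 2`: outcome `-1` of measuring `Z`, followed by a bit flip. Both
operations preserve stabilizer lines. -/
theorem lowering_singleton_eq (i : Fin n) :
    lowering {i} = (2⁻¹ : ℂ) •
      (tensorOp (fun j => pauliMatrix (if j = i then 1 else 0)) *
        (1 - tensorOp fun j => pauliMatrix (if j = i then 3 else 0))) := by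
  have key : ∀ A B C : Matrix (Fin 2) (Fin 2) ℂ, A = (2⁻¹ : ℂ) • (B - C) →
      (tensorOp fun j => if j = i then A else 1) = (2⁻¹ : ℂ) •
        ((tensorOp fun j => if j = i then B else 1) - tensorOp fun j => if j = i then C else 1) := by
    intro A B C h
    ext x y
    simp only [tensorOp, Matrix.of_apply, Matrix.smul_apply, Matrix.sub_apply, smul_eq_mul,
      ← Finset.mul_prod_erase _ _ (Finset.mem_univ i), if_true, h]
    have he : ∀ D : Matrix (Fin 2) (Fin 2) ℂ,
        ∏ j ∈ Finset.univ.erase i, (if j = i then D else 1) (x j) (y j) =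
          ∏ j ∈ Finset.univ.erase i, (1 : Matrix (Fin 2) (Fin 2) ℂ) (x j) (y j) := fun D =>
      Finset.prod_congr rfl fun j hj => by rw [if_neg (Finset.ne_of_mem_erase hj)]
    rw [he, he, he]
    ring
  rw [Matrix.mul_sub, Matrix.mul_one, tensorOp_mul]
  simp only [lowering, Finset.mem_singleton]
  rw [key _ (pauliMatrix 1) (pauliMatrix 1 * pauliMatrix 3)]
  · congr 3
    · funext j; split_ifs <;> simp [pauliMatrix]
    · funext j; split_ifs <;> simp [pauliMatrix]
  · ext a b
    fin_cases a <;> fin_cases b <;> norm_num [pauliMatrix]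

theorem SpansStabilizerLine.lowering_mulVec {φ : QubitVec n} (h : SpansStabilizerLine φ)
    (J : Finset (Fin n)) : SpansStabilizerLine (lowering J *ᵥ φ) := by
  induction J using Finset.induction_on with
  | empty => simpa [lowering_empty] using h
  | insert i J hi ih =>
    have hsq : ∀ a : Fin n → Fin 4, tensorOp (fun j => pauliMatrix (a j)) *
        tensorOp (fun j => pauliMatrix (a j)) = 1 := fun a => by
      simp [tensorOp_mul, pauliMatrix_mul_self, tensorOp_one]
    rw [lowering_insert hi, ← Matrix.mulVec_mulVec, lowering_singleton_eq, Matrix.smul_mulVec,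
      ← Matrix.mulVec_mulVec, Matrix.sub_mulVec, Matrix.one_mulVec]
    exact ((ih.sub_pauli_mulVec (tensorOp_mem_pauliGroup _) (hsq _)).pauli_mulVec
      (tensorOp_mem_pauliGroup _) (hsq _)).smul _

theorem lowering_apply_ne_zero {J : Finset (Fin n)} {x y : BitString n}
    (h : lowering J x y ≠ 0) (i : Fin n) :
    (i ∈ J → x i = 0 ∧ y i = 1) ∧ (i ∉ J → x i = y i) := by
  simp only [lowering, tensorOp, Matrix.of_apply, Finset.prod_ne_zero_iff] at h
  have hi := h i (Finset.mem_univ i)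
  constructor <;> intro hJ
  · rw [if_pos hJ] at hi
    generalize x i = a at *
    generalize y i = b at *
    fin_cases a <;> fin_cases b <;> simp_all
  · rw [if_neg hJ] at hi
    by_contra hne
    exact hi (Matrix.one_apply_ne hne)

theorem hammingNorm_of_lowering_apply_ne_zero {J : Finset (Fin n)} {x y : BitString n}
    (h : lowering J x y ≠ 0) : hammingNorm y = hammingNorm x + J.card := by
  have hd : Disjoint (Finset.univ.filter fun i => x i ≠ 0) J := by
    refine Finset.disjoint_left.2 fun i hi hJ => ?_
    exact (Finset.mem_filter.1 hi).2 ((lowering_apply_ne_zero h i).1 hJ).1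
  rw [hammingNorm, hammingNorm, ← Finset.card_union_of_disjoint hd]
  congr 1
  ext i
  have := lowering_apply_ne_zero h i
  by_cases hJ : i ∈ J
  · simp [hJ, (this.1 hJ).2]
  · simp [hJ, this.2 hJ]

/-- Each jump contributes `√γ`. Each output bit `1` contributes `√(1-γ)`, and jumped qubits end in
`0`, so the second exponent is the weight of the output string `x`. -/
theorem dampingBranch_apply (γ : ℝ) (J : Finset (Fin n)) (x y : BitString n) :
    dampingBranch γ J x y =
      ((√γ : ℝ) : ℂ) ^ J.card * ((√(1 - γ) : ℝ) : ℂ) ^ hammingNorm x * lowering J x y := by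
  have h : ∀ (i : Fin n), (if i ∈ J then dampingKraus₁ γ else dampingKraus₀ γ) (x i) (y i) =
      (if i ∈ J then ((√γ : ℝ) : ℂ) else 1) * (if x i ≠ 0 then ((√(1 - γ) : ℝ) : ℂ) else 1) *
        (if i ∈ J then !![0, 1; 0, 0] else 1 : Matrix (Fin 2) (Fin 2) ℂ) (x i) (y i) := by
    intro i
    generalize x i = a
    generalize y i = b
    split_ifs <;> fin_cases a <;> fin_cases b <;> simp_all [dampingKraus₀, dampingKraus₁]
  simp only [dampingBranch, lowering, tensorOp, Matrix.of_apply, h, Finset.prod_mul_distrib]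
  congr 2
  · simp
  · simp [Finset.prod_ite, hammingNorm]

theorem HasConstantWeightSupport.exists_dampingBranch_mulVec_eq {φ : QubitVec n}
    (h : HasConstantWeightSupport φ) (γ : ℝ) (J : Finset (Fin n)) :
    ∃ c : ℂ, dampingBranch γ J *ᵥ φ = c • (lowering J *ᵥ φ) := by
  rcases eq_or_ne φ 0 with rfl | h0
  · exact ⟨0, by simp⟩
  obtain ⟨z, hz⟩ := Function.ne_iff.1 h0
  -- Every surviving output string has weight `hammingNorm z - J.card`. Where the subtraction
  -- truncates, no string survives and both sides vanish.
  refine ⟨((√γ : ℝ) : ℂ) ^ J.card * ((√(1 - γ) : ℝ) : ℂ) ^ (hammingNorm z - J.card), ?_⟩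
  funext x
  simp only [Matrix.mulVec, dotProduct, Pi.smul_apply, smul_eq_mul, Finset.mul_sum]
  refine Finset.sum_congr rfl fun y _ => ?_
  rw [dampingBranch_apply]
  by_cases hy : φ y = 0
  · simp [hy]
  by_cases hl : lowering J x y = 0
  · simp [hl]
  rw [h z hz y hy, hammingNorm_of_lowering_apply_ne_zero hl, Nat.add_sub_cancel, mul_assoc]

theorem IsPureStabilizer.isMagicInsulator {φ : QubitVec n} (hφ : IsPureStabilizer φ)
    (h : HasConstantWeightSupport φ) : IsMagicInsulator φ := by
  intro γ hγ
  have hbranch : ∀ J : Finset (Fin n), ∃ σ ∈ stabilizerPolytope n,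
      ketbra (dampingBranch γ J *ᵥ φ) = (∑ x, ‖(dampingBranch γ J *ᵥ φ) x‖ ^ 2) • σ := by
    intro J
    by_cases h0 : dampingBranch γ J *ᵥ φ = 0
    -- A vanishing branch has weight zero, so any point of the polytope serves.
    · exact ⟨_, hφ.ketbra_mem, by ext; simp [h0, ketbra, Matrix.vecMulVec_apply]⟩
    · obtain ⟨c, hc⟩ := h.exists_dampingBranch_mulVec_eq γ J
      refine SpansStabilizerLine.exists_ketbra ?_ h0
      rw [hc]
      exact (hφ.spansStabilizerLine.lowering_mulVec J).smul c
  choose σ hσ heq using hbranch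
  rw [amplitudeDamping_ketbra, Finset.sum_congr rfl fun J _ => heq J]
  exact (convex_convexHull ℝ _).sum_mem (fun J _ => Finset.sum_nonneg fun _ _ => by positivity)
    (by rw [sum_norm_sq_dampingBranch hγ, hφ.1]) fun J _ => hσ J

theorem dampingBranch_empty_mulVec_apply (γ : ℝ) (φ : QubitVec n) (x : BitString n) :
    (dampingBranch γ ∅ *ᵥ φ) x = ((√(1 - γ) : ℝ) : ℂ) ^ hammingNorm x * φ x := by
  simp [Matrix.mulVec, dotProduct, dampingBranch_apply, lowering_empty, Matrix.one_apply]

/-- A string of maximal weight in the support of `φ` is only reached by the no-jump branch. -/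
theorem dampingBranch_mulVec_apply_eq_zero {φ : QubitVec n} {v : BitString n}
    (hv : ∀ x, φ x ≠ 0 → hammingNorm x ≤ hammingNorm v) (γ : ℝ) {J : Finset (Fin n)}
    (hJ : J ≠ ∅) : (dampingBranch γ J *ᵥ φ) v = 0 := by
  rw [Matrix.mulVec, dotProduct]
  refine Finset.sum_eq_zero fun y _ => ?_
  rw [dampingBranch_apply]
  by_cases hl : lowering J v y = 0
  · simp [hl]
  by_cases hy : φ y = 0
  · simp [hy]
  have h1 := hammingNorm_of_lowering_apply_ne_zero hl
  have h2 := hv y hy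
  have h3 := Finset.card_pos.2 (Finset.nonempty_iff_ne_empty.2 hJ)
  omega

theorem amplitudeDamping_ketbra_apply {φ : QubitVec n} {v : BitString n}
    (hv : ∀ x, φ x ≠ 0 → hammingNorm x ≤ hammingNorm v) (γ : ℝ) (u : BitString n) :
    amplitudeDamping γ (ketbra φ) u v =
      (((√(1 - γ) : ℝ) : ℂ) ^ hammingNorm u * φ u) *
        star (((√(1 - γ) : ℝ) : ℂ) ^ hammingNorm v * φ v) := by
  rw [amplitudeDamping_ketbra, Matrix.sum_apply, Finset.sum_eq_single ∅]
  · simp only [ketbra, Matrix.vecMulVec_apply, Pi.star_apply, dampingBranch_empty_mulVec_apply]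
  · intro J _ hJ
    simp [ketbra, Matrix.vecMulVec_apply, dampingBranch_mulVec_apply_eq_zero hv γ hJ]
  · simp

theorem IsPureStabilizer.isMagicGenerator {φ : QubitVec n} (hφ : IsPureStabilizer φ)
    (h : ¬ HasConstantWeightSupport φ) : IsMagicGenerator φ := by
  intro γ hγ hmem
  simp only [HasConstantWeightSupport, not_forall, Function.mem_support] at h
  obtain ⟨x, hx, y, hy, hxy⟩ := h
  obtain ⟨v, hv, hmax⟩ := (Finset.univ.filter fun z => φ z ≠ 0).exists_max_image hammingNorm
    ⟨x, by simpa using hx⟩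
  simp only [Finset.mem_filter, Finset.mem_univ, true_and] at hv hmax
  obtain ⟨u, hu, huv⟩ : ∃ u, φ u ≠ 0 ∧ hammingNorm u < hammingNorm v := by
    rcases (hmax x hx).lt_or_eq with h1 | h1
    · exact ⟨x, hx, h1⟩
    · exact ⟨y, hy, (hmax y hy).lt_of_ne fun h2 => hxy (h1.trans h2.symm)⟩
  have hle := norm_apply_le_of_mem_stabilizerPolytope hmem u v
  set s : ℝ := √(1 - γ)
  have hs0 : 0 < s := Real.sqrt_pos.2 (sub_pos.2 hγ.2)
  have hs1 : s < 1 := by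
    rw [Real.sqrt_lt' one_pos]
    linarith [hγ.1]
  rw [amplitudeDamping_ketbra_apply hmax, amplitudeDamping_ketbra_apply hmax, RCLike.star_def,
    Complex.mul_conj, Complex.ofReal_re, Complex.normSq_eq_norm_sq, sq, norm_mul,
    RCLike.norm_conj, norm_mul, norm_mul, norm_pow, norm_pow, Complex.norm_real,
    Real.norm_of_nonneg hs0.le, hφ.spansStabilizerLine.norm_apply_eq hu hv] at hle
  have hvpos := norm_pos_iff.2 hv
  -- Cancelling the common factors leaves `s ^ hammingNorm u ≤ s ^ hammingNorm v`, impossible for `0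
  -- < s < 1`.
  have h1 := le_of_mul_le_mul_right hle (by positivity)
  have h2 := le_of_mul_le_mul_right h1 hvpos
  exact h2.not_gt (pow_lt_pow_right_of_lt_one₀ hs0 hs1 huv)

end Damping

theorem propositionS (n : ℕ) (φ : QubitVec n) (hφ : IsPureStabilizer φ) :
    (IsMagicInsulator φ ↔ HasConstantWeightSupport φ) ∧
      (¬ HasConstantWeightSupport φ → IsMagicGenerator φ) := by
  refine ⟨⟨fun h => ?_, hφ.isMagicInsulator⟩, hφ.isMagicGenerator⟩
  by_contra hne
  -- Any strength strictly between `0` and `1` would do.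
  exact hφ.isMagicGenerator hne (1 / 2) (by norm_num) (h (1 / 2) (by norm_num))
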